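/- Let $\mathbb H=\{z\in\mathbb C:\operatorname{Im} z>0\}$ and, for $z\in\mathbb H$, let $p_z(x)=\dfrac{\operatorname{Im} z}{\pi|x-z|^2}$ $(x\in\mathbb R)$ be the Cauchy density with location $\operatorname{Re} z$ and scale $\operatorname{Im} z$. For $z,w\in\mathbb H$ put $$D_{\mathrm{KL}}(p_z:p_w)=\int_{\mathbb R}p_z(x)\log\frac{p_z(x)}{p_w(x)}\,dx,\qquad D_{\mathrm{Bhat}}(p_z:p_w)=-\log\int_{\mathbb R}\sqrt{p_z(x)p_w(x)}\,dx .$$ Let $d$ be either of the functions $(z,w)\mapsto\sqrt{D_{\mathrm{KL}}(p_z:p_w)}$ and $(z,w)\mapsto\sqrt{D_{\mathrm{Bhat}}(p_z:p_w)}$ on $\mathbb H\times\mathbb H$. Then: 1. $d$ is a metric on $\mathbb H$, and the metric space $(\mathbb H,d)$ is complete. 2. $(\mathbb H,d)$ is not a geodesic metric space; that is, it is not true that for all $z,w\in\mathbb H$ there is a map $\gamma:[0,d(z,w)]\to\mathbb H$ with $\gamma(0)=z$, $\gamma(d(z,w))=w$ and $d(\gamma(s),\gamma(t))=|s-t|$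 for all $s,t$. 3. $d$ is not a Riemannian distance; that is, there is no smooth Riemannian metric $g$ on $\mathbb H$ (with its standard smooth structure as an open subset of $\mathbb C$) such that, for all $z,w\in\mathbb H$, $d(z,w)$ is the infimum of the $g$-lengths of the $C^1$ paths from $z$ to $w$. -/

import Mathlib

open scoped UpperHalfPlane Manifold ContDiff Bundle

noncomputable section

namespace CauchyDivergence

/-- The Cauchy density `p_z` with location `Re z` and scale `Im z`, where `z ∈ ℍ`. -/
def density (z : ℍ) : ℝ → ℝ :=
  ProbabilityTheory.cauchyPDFReal z.re z.im.toNNReal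

/-- McCullagh's complex form of the density: `p_z(x) = Im z / (π |x - z|²)`. -/
theorem density_eq (z : ℍ) (x : ℝ) :
    density z x = z.im / (Real.pi * ‖(x : ℂ) - (z : ℂ)‖ ^ 2) := by
  have h : ‖(x : ℂ) - (z : ℂ)‖ ^ 2 = (x - z.re) ^ 2 + z.im ^ 2 := by
    rw [← Complex.normSq_eq_norm_sq, Complex.normSq_apply]
    simp
    ring
  rw [h, density, ProbabilityTheory.cauchyPDFReal_def,
    Real.coe_toNNReal _ z.im_pos.le, div_eq_mul_inv, mul_inv]
  ring

/-- The Kullback-Leibler divergence `∫ p log (p / q) dx` between densities on `ℝ`. -/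
def klDivergence (p q : ℝ → ℝ) : ℝ :=
  ∫ x, p x * Real.log (p x / q x)

/-- The Bhattacharyya divergence `-log ∫ √(p q) dx` between densities on `ℝ`. -/
def bhatDivergence (p q : ℝ → ℝ) : ℝ :=
  -Real.log (∫ x, √(p x * q x))

/-- `√D_KL` between Cauchy densities, as a function of the parameters in `ℍ`. -/
def sqrtKL (z w : ℍ) : ℝ :=
  √(klDivergence (density z) (density w))

/-- `√D_Bhat` between Cauchy densities, as a function of the parameters in `ℍ`. -/
def sqrtBhat (z w : ℍ) : ℝ :=
  √(bhatDivergence (density z) (density w))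

/-- A metric space is geodesic if any two points `x`, `y` are joined by a geodesic, i.e. by an
isometric embedding of the interval `[0, dist x y]` that starts at `x` and ends at `y`. -/
def IsGeodesicSpace (X : Type*) [MetricSpace X] : Prop :=
  ∀ x y : X, ∃ γ : ℝ → X, γ 0 = x ∧ γ (dist x y) = y ∧
    ∀ s ∈ Set.Icc 0 (dist x y), ∀ t ∈ Set.Icc 0 (dist x y), dist (γ s) (γ t) = |s - t|

/-- The standard structure of a real-analytic surface on `ℍ`, as an open subset of `ℂ`. -/
instance : IsManifold 𝓘(ℝ, ℂ) ω ℍ :=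
  UpperHalfPlane.isOpenEmbedding_coe.isManifold_singleton

/-- The distance of a smooth Riemannian metric `g` on `ℍ`: the infimum of the `g`-lengths of the
`C^1` paths between two points (a real number, since `ℍ` is connected). -/
def riemannianDist
    (g : Bundle.ContMDiffRiemannianMetric 𝓘(ℝ, ℂ) ∞ ℂ (fun z : ℍ ↦ TangentSpace 𝓘(ℝ, ℂ) z))
    (z w : ℍ) : ℝ :=
  letI : Bundle.RiemannianBundle (fun z : ℍ ↦ TangentSpace 𝓘(ℝ, ℂ) z) := ⟨g.toRiemannianMetric⟩
  (Manifold.riemannianEDist 𝓘(ℝ, ℂ) z w).toReal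

/-- `d` is a Riemannian distance on `ℍ`: it is the distance of some smooth Riemannian metric. -/
def IsRiemannianDistance (d : ℍ → ℍ → ℝ) : Prop :=
  ∃ g : Bundle.ContMDiffRiemannianMetric 𝓘(ℝ, ℂ) ∞ ℂ (fun z : ℍ ↦ TangentSpace 𝓘(ℝ, ℂ) z),
    ∀ z w : ℍ, d z w = riemannianDist g z w

end CauchyDivergence

end

namespace CauchyDivergence

open Set Filter Topology

/-! ### Calculus of `log cosh` -/

/-! Substituting `x = Re z + Im z * tan φ` makes `p_z dx` uniform in `φ`. Up to a phase, the ratio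
`p_w / p_z` becomes `1 / (cosh ρ - sinh ρ cos t)`, where `ρ` is the hyperbolic distance
(`integral_density_mul`). Hence each divergence is a function `F ρ`.

If `F` is positive and increasing, `F x ≤ x ^ 2` and `F x / x ^ 2` is strictly decreasing, then `f =
√F` has `f x / x` strictly decreasing (`IsDistGauge`). So `f` is subadditive and `f ∘ dist` is a
metric, which inherits completeness. Moreover `f (2 * x) < 2 * f x` excludes approximate midpoints,
which geodesics and nearly minimizing paths would supply.

For Kullback-Leibler, `F x = 2 log cosh (x / 2)`. For Bhattacharyya, `F` involves an elliptic
integral, and Landen's transformation gives `F x = T / 2 + F T` with `T = log cosh (x / 2)`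
(`bhatCoeff_eq`). As `T ≤ x / 2`, `F` is the limit of this recursion started at `0`, so the
estimates that the recursion preserves pass to `F`. -/

theorem pos_of_hasDerivAt_pos {g g' : ℝ → ℝ} (h0 : g 0 = 0)
    (hg : ∀ x, 0 ≤ x → HasDerivAt g (g' x) x) (hg' : ∀ x, 0 < x → 0 < g' x) {x : ℝ}
    (hx : 0 < x) : 0 < g x := by
  have hmono : StrictMonoOn g (Ici 0) := by
    refine strictMonoOn_of_deriv_pos (convex_Ici 0)
      (fun y hy ↦ (hg y hy).continuousAt.continuousWithinAt) fun y hy ↦ ?_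
    rw [interior_Ici] at hy
    rw [(hg y (le_of_lt hy)).deriv]
    exact hg' y hy
  simpa [h0] using hmono self_mem_Ici hx.le hx

/-- The hypothesis `h` says that `g u / u ^ 2` has negative derivative. -/
theorem mul_sq_lt_mul_sq_of_hasDerivAt {g g' : ℝ → ℝ}
    (hg : ∀ x, 0 < x → HasDerivAt g (g' x) x) (h : ∀ x, 0 < x → x * g' x < 2 * g x)
    {x y : ℝ} (hx : 0 < x) (hxy : x < y) : g y * x ^ 2 < g x * y ^ 2 := by
  have hd (u : ℝ) (hu : 0 < u) :
      HasDerivAt (fun u ↦ g u / u ^ 2) ((g' u * u ^ 2 - g u * (2 * u)) / (u ^ 2) ^ 2) u := by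
    exact ((hg u hu).fun_div (hasDerivAt_pow 2 u) (by positivity)).congr_deriv (by simp)
  have hanti : StrictAntiOn (fun u ↦ g u / u ^ 2) (Ioi 0) := by
    refine strictAntiOn_of_deriv_neg (convex_Ioi 0)
      (fun u hu ↦ (hd u hu).continuousAt.continuousWithinAt) fun u hu ↦ ?_
    rw [interior_Ioi] at hu
    have hu : 0 < u := hu
    rw [(hd u hu).deriv]
    refine div_neg_of_neg_of_pos ?_ (by positivity)
    nlinarith [h u hu]
  have hy : 0 < y := hx.trans hxy
  have := hanti (mem_Ioi.2 hx) (mem_Ioi.2 hy) hxy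
  rwa [div_lt_div_iff₀ (by positivity) (by positivity)] at this

noncomputable def logCosh (r : ℝ) : ℝ := Real.log (Real.cosh r)

theorem exp_logCosh (r : ℝ) : Real.exp (logCosh r) = Real.cosh r :=
  Real.exp_log (Real.cosh_pos r)

@[simp] theorem logCosh_zero : logCosh 0 = 0 := by simp [logCosh]

theorem logCosh_nonneg (r : ℝ) : 0 ≤ logCosh r := Real.log_nonneg (Real.one_le_cosh r)

theorem logCosh_pos {r : ℝ} (hr : 0 < r) : 0 < logCosh r :=
  Real.log_pos (Real.one_lt_cosh.2 hr.ne')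

theorem logCosh_le {r : ℝ} (hr : 0 ≤ r) : logCosh r ≤ r := by
  rw [logCosh, Real.log_le_iff_le_exp (Real.cosh_pos r), Real.cosh_eq]
  linarith [Real.exp_le_exp.2 (by linarith : -r ≤ r)]

theorem logCosh_mono {r s : ℝ} (hr : 0 ≤ r) (hrs : r ≤ s) : logCosh r ≤ logCosh s := by
  refine Real.log_le_log (Real.cosh_pos r) (Real.cosh_le_cosh.2 ?_)
  rwa [abs_of_nonneg hr, abs_of_nonneg (hr.trans hrs)]

theorem hasDerivAt_logCosh (r : ℝ) :
    HasDerivAt logCosh (Real.sinh r / Real.cosh r) r :=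
  (Real.hasDerivAt_cosh r).log (Real.cosh_pos r).ne'

theorem hasDerivAt_logCosh_half (x : ℝ) : HasDerivAt (fun x ↦ logCosh (x / 2))
    (Real.sinh (x / 2) / Real.cosh (x / 2) * (1 / 2)) x :=
  HasDerivAt.comp (h₂ := logCosh) x (hasDerivAt_logCosh (x / 2))
    ((hasDerivAt_id x).div_const 2)

theorem hasDerivAt_sinh_div_cosh (r : ℝ) :
    HasDerivAt (fun r ↦ Real.sinh r / Real.cosh r) (1 / Real.cosh r ^ 2) r := by
  refine ((Real.hasDerivAt_sinh r).div (Real.hasDerivAt_cosh r) (Real.cosh_pos r).ne').congr_deriv ?_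
  rw [← Real.cosh_sq_sub_sinh_sq r]
  ring

theorem self_lt_sinh_mul_cosh {r : ℝ} (hr : 0 < r) : r < Real.sinh r * Real.cosh r := by
  nlinarith [Real.self_lt_sinh_iff.2 hr, Real.one_le_cosh r]

theorem mul_sinh_div_cosh_lt {r : ℝ} (hr : 0 < r) :
    r * (Real.sinh r / Real.cosh r) < 2 * logCosh r := by
  have h := pos_of_hasDerivAt_pos
    (g := fun r ↦ 2 * logCosh r - r * (Real.sinh r / Real.cosh r))
    (g' := fun r ↦ (Real.sinh r * Real.cosh r - r) / Real.cosh r ^ 2) (by simp)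
    (fun r _ ↦ (((hasDerivAt_logCosh r).const_mul 2).sub
      ((hasDerivAt_id r).mul (hasDerivAt_sinh_div_cosh r))).congr_deriv ?_)
    (fun r hr ↦ ?_) hr
  · linarith
  · have := (Real.cosh_pos r).ne'
    simp only [id]
    field_simp
    ring
  · have := self_lt_sinh_mul_cosh hr
    have := Real.cosh_pos r
    exact div_pos (by linarith) (by positivity)

theorem logCosh_add_four_sq_le (r : ℝ) : (logCosh r + 4) ^ 2 ≤ 16 * Real.cosh r := by
  have h := Real.add_one_le_exp (logCosh r / 2)
  have h2 : Real.exp (logCosh r / 2) ^ 2 = Real.cosh r := by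
    rw [← Real.exp_nat_mul, ← exp_logCosh]
    ring_nf
  have h0 := logCosh_nonneg r
  rw [← h2]
  nlinarith

/-- With `L = logCosh r`, the right side is `(L + 4) ^ 2 - 16`. Dividing by `L + 4` leaves a
function whose derivative is positive by `(L + 4) ^ 2 ≤ 16 cosh r` and `r < sinh r`. -/
theorem mul_sinh_div_cosh_mul_lt {r : ℝ} (hr : 0 < r) :
    r * (Real.sinh r / Real.cosh r) * (logCosh r + 4) < logCosh r ^ 2 + 8 * logCosh r := by
  have hL (r : ℝ) : 0 < logCosh r + 4 := by linarith [logCosh_nonneg r]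
  have h := pos_of_hasDerivAt_pos
    (g := fun r ↦ logCosh r + 4 - 16 * (logCosh r + 4)⁻¹ - r * (Real.sinh r / Real.cosh r))
    (g' := fun r ↦ (16 * Real.sinh r * Real.cosh r / (logCosh r + 4) ^ 2 - r) / Real.cosh r ^ 2)
    (by norm_num)
    (fun r _ ↦ ((((hasDerivAt_logCosh r).add_const 4).sub
      ((((hasDerivAt_logCosh r).add_const 4).fun_inv (hL r).ne').const_mul 16)).sub
      ((hasDerivAt_id r).mul (hasDerivAt_sinh_div_cosh r))).congr_deriv ?_)
    (fun r hr ↦ ?_) hr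
  · have := mul_pos h (hL r)
    have h4 := (hL r).ne'
    have e : (logCosh r + 4 - 16 * (logCosh r + 4)⁻¹ - r * (Real.sinh r / Real.cosh r)) *
        (logCosh r + 4) = (logCosh r + 4) ^ 2 - 16 -
          r * (Real.sinh r / Real.cosh r) * (logCosh r + 4) := by
      field_simp
    nlinarith
  · have := (Real.cosh_pos r).ne'
    have := (hL r).ne'
    simp only [id]
    field_simp
    ring
  · have h1 := Real.self_lt_sinh_iff.2 hr
    have h2 := logCosh_add_four_sq_le r
    have hc := Real.cosh_pos r
    refine div_pos (sub_pos.2 ?_) (by positivity)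
    rw [lt_div_iff₀ (pow_pos (hL r) 2)]
    nlinarith

/-- Differentiating the difference twice reduces this to `logCosh r < 3 * sinh r ^ 2`, which follows
from `log c ≤ c - 1` at `c = cosh r`. -/
theorem logCosh_sq_add_le {r : ℝ} (hr : 0 ≤ r) : logCosh r ^ 2 + 8 * logCosh r ≤ 4 * r ^ 2 := by
  rcases hr.eq_or_lt with rfl | hr
  · simp
  have h1 {r : ℝ} (hr : 0 < r) : 0 < 4 * r - (logCosh r + 4) * (Real.sinh r / Real.cosh r) := by
    refine pos_of_hasDerivAt_pos
      (g := fun r ↦ 4 * r - (logCosh r + 4) * (Real.sinh r / Real.cosh r))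
      (g' := fun r ↦ (3 * Real.sinh r ^ 2 - logCosh r) / Real.cosh r ^ 2) (by simp)
      (fun r _ ↦ (((hasDerivAt_id r).const_mul 4).sub
      (((hasDerivAt_logCosh r).add_const 4).mul (hasDerivAt_sinh_div_cosh r))).congr_deriv ?_)
      (fun r hr ↦ ?_) hr
    · have := (Real.cosh_pos r).ne'
      field_simp
      rw [Real.sinh_sq]
      ring
    · have hc := Real.cosh_pos r
      refine div_pos (sub_pos.2 ?_) (by positivity)
      have h2 := Real.add_one_le_exp (logCosh r)
      rw [exp_logCosh] at h2
      rw [Real.sinh_sq]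
      nlinarith [Real.one_lt_cosh.2 hr.ne']
  have h2 := pos_of_hasDerivAt_pos
    (g := fun r ↦ 4 * r ^ 2 - (logCosh r ^ 2 + 8 * logCosh r))
    (g' := fun r ↦ 2 * (4 * r - (logCosh r + 4) * (Real.sinh r / Real.cosh r))) (by simp)
    (fun r _ ↦ (((hasDerivAt_pow 2 r).const_mul 4).sub
      (((hasDerivAt_logCosh r).pow 2).add ((hasDerivAt_logCosh r).const_mul 8))).congr_deriv (by
        simp; ring))
    (fun r hr ↦ by linarith [h1 hr]) hr
  linarith

theorem logCosh_half_mul_sq_lt {x y : ℝ} (hx : 0 < x) (hxy : x < y) :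
    logCosh (y / 2) * x ^ 2 < logCosh (x / 2) * y ^ 2 := by
  refine mul_sq_lt_mul_sq_of_hasDerivAt (g := fun x ↦ logCosh (x / 2))
    (fun x _ ↦ hasDerivAt_logCosh_half x) (fun x hx ↦ ?_) hx hxy
  linarith [mul_sinh_div_cosh_lt (half_pos hx)]

theorem logCosh_half_sq_add_mul_sq_lt {x y : ℝ} (hx : 0 < x) (hxy : x < y) :
    (logCosh (y / 2) ^ 2 + 8 * logCosh (y / 2)) * x ^ 2 <
      (logCosh (x / 2) ^ 2 + 8 * logCosh (x / 2)) * y ^ 2 := by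
  refine mul_sq_lt_mul_sq_of_hasDerivAt (g := fun x ↦ logCosh (x / 2) ^ 2 + 8 * logCosh (x / 2))
    (g' := fun x ↦ Real.sinh (x / 2) / Real.cosh (x / 2) * (logCosh (x / 2) + 4))
    (fun x _ ↦ (((hasDerivAt_logCosh_half x).pow 2).add
      ((hasDerivAt_logCosh_half x).const_mul 8)).congr_deriv (by simp; ring))
    (fun x hx ↦ ?_) hx hxy
  linarith [mul_sinh_div_cosh_mul_lt (half_pos hx)]

/-! ### The Landen functional equation -/

/-- One step of the recursion `F x = log (cosh (x / 2)) / 2 + F (log (cosh (x / 2)))`. -/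
noncomputable def landen (F : ℝ → ℝ) (x : ℝ) : ℝ :=
  logCosh (x / 2) / 2 + F (logCosh (x / 2))

/-- Properties, preserved by `landen`, of a function that grows at most quadratically. -/
structure IsQuadraticGauge (F : ℝ → ℝ) : Prop where
  nonneg : ∀ x, 0 ≤ x → 0 ≤ F x
  le_sq : ∀ x, 0 ≤ x → F x ≤ x ^ 2 / 16
  mono : ∀ x y, 0 ≤ x → x ≤ y → F x ≤ F y
  mul_sq_le : ∀ x y, 0 < x → x ≤ y → F y * x ^ 2 ≤ F x * y ^ 2

/-- Writing `F a = c * a ^ 2`, one has `F b ≤ c * b ^ 2`, and `b / 2 + c * b ^ 2 = 8 * (1 / 16 - c)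
* b + c * (b ^ 2 + 8 * b)`. For `0 ≤ c ≤ 1 / 16` this is a nonnegative combination of the two
quantities controlled by `h1` and `h2`. The inequality comes out strict even though that for `F` is
weak. -/
theorem IsQuadraticGauge.landen_mul_sq_lt {F : ℝ → ℝ} (hF : IsQuadraticGauge F) {x y : ℝ}
    (hx : 0 < x) (hxy : x < y) : landen F y * x ^ 2 < landen F x * y ^ 2 := by
  have h1 := logCosh_half_mul_sq_lt hx hxy
  have h2 := logCosh_half_sq_add_mul_sq_lt hx hxy
  have hT := logCosh_pos (half_pos hx)
  have hTT := logCosh_mono (half_pos hx).le (by linarith : x / 2 ≤ y / 2)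
  unfold landen
  set a := logCosh (x / 2)
  set b := logCosh (y / 2)
  have h3 := hF.mul_sq_le a b hT hTT
  have h4 := hF.nonneg a hT.le
  have h5 := hF.le_sq a hT.le
  obtain ⟨c, hc⟩ : ∃ c, F a = c * a ^ 2 := ⟨F a / a ^ 2, by field_simp⟩
  have ha : 0 < a ^ 2 := by positivity
  rw [hc] at h3 h4 h5 ⊢
  have hc0 : 0 ≤ c := nonneg_of_mul_nonneg_left h4 ha
  have hc1 : c ≤ 1 / 16 := by nlinarith
  have h6 : F b ≤ c * b ^ 2 := by nlinarith
  have h7 : F b * x ^ 2 ≤ c * b ^ 2 * x ^ 2 := by gcongr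
  have h8 := mul_nonneg hc0 (sub_pos.2 h2).le
  rcases hc1.eq_or_lt with rfl | hc1
  · linarith
  · have h9 := mul_pos (sub_pos.2 hc1) (sub_pos.2 h1)
    linarith

theorem IsQuadraticGauge.landen {F : ℝ → ℝ} (hF : IsQuadraticGauge F) :
    IsQuadraticGauge (landen F) where
  nonneg x _ := add_nonneg (div_nonneg (logCosh_nonneg (x / 2)) zero_le_two) (hF.nonneg _ (logCosh_nonneg _))
  le_sq x hx := by
    have h1 := hF.le_sq _ (logCosh_nonneg (x / 2))
    -- The constant `1 / 16` is reproduced: `T / 2 + T ^ 2 / 16 = (T ^ 2 + 8 * T) / 16 ≤ x ^ 2 /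
    -- 16`.
    have h2 := logCosh_sq_add_le (div_nonneg hx zero_le_two)
    unfold CauchyDivergence.landen
    linarith
  mono x y hx hxy := by
    have h := logCosh_mono (div_nonneg hx zero_le_two) (by linarith : x / 2 ≤ y / 2)
    have := hF.mono _ _ (logCosh_nonneg (x / 2)) h
    unfold CauchyDivergence.landen
    linarith
  mul_sq_le x y hx hxy := by
    rcases hxy.eq_or_lt with rfl | hxy
    · rfl
    · exact (hF.landen_mul_sq_lt hx hxy).le

theorem isQuadraticGauge_zero : IsQuadraticGauge 0 := by
  constructor <;> intros <;> simp; positivity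

theorem IsQuadraticGauge.of_tendsto {u : ℕ → ℝ → ℝ} {F : ℝ → ℝ} (hu : ∀ n, IsQuadraticGauge (u n))
    (h : ∀ x, 0 ≤ x → Tendsto (fun n ↦ u n x) atTop (𝓝 (F x))) : IsQuadraticGauge F where
  nonneg x hx := ge_of_tendsto' (h x hx) fun n ↦ (hu n).nonneg x hx
  le_sq x hx := le_of_tendsto' (h x hx) fun n ↦ (hu n).le_sq x hx
  mono x y hx hxy :=
    le_of_tendsto_of_tendsto' (h x hx) (h y (hx.trans hxy)) fun n ↦ (hu n).mono x y hx hxy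
  mul_sq_le x y hx hxy :=
    le_of_tendsto_of_tendsto' ((h y (hx.le.trans hxy)).mul_const _) ((h x hx.le).mul_const _)
      fun n ↦ (hu n).mul_sq_le x y hx hxy

/-- The explicit terms of the recursion cancel in the difference, and each step at least halves the
argument. -/
theorem abs_sub_landen_iterate_le {F : ℝ → ℝ} (hF : ∀ x, 0 ≤ x → |F x| ≤ x)
    (h : ∀ x, 0 ≤ x → F x = landen F x) (n : ℕ) {x : ℝ} (hx : 0 ≤ x) :
    |F x - landen^[n] 0 x| ≤ x * (1 / 2) ^ n := by
  induction n generalizing x with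
  | zero => simpa using hF x hx
  | succ n ih =>
    rw [Function.iterate_succ_apply', h x hx]
    unfold landen
    rw [add_sub_add_left_eq_sub]
    refine (ih (logCosh_nonneg _)).trans ?_
    rw [pow_succ', ← mul_assoc]
    gcongr
    linarith [logCosh_le (div_nonneg hx zero_le_two)]

theorem isQuadraticGauge_of_eq_landen {F : ℝ → ℝ} (hF : ∀ x, 0 ≤ x → |F x| ≤ x)
    (h : ∀ x, 0 ≤ x → F x = landen F x) : IsQuadraticGauge F := by
  refine .of_tendsto (u := fun n ↦ landen^[n] 0) (fun n ↦ ?_) fun x hx ↦ ?_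
  · induction n with
    | zero => exact isQuadraticGauge_zero
    | succ n ih =>
      rw [Function.iterate_succ_apply']
      exact ih.landen
  · rw [tendsto_iff_dist_tendsto_zero]
    refine squeeze_zero (fun _ ↦ dist_nonneg) (g := fun n ↦ x * (1 / 2) ^ n) (fun n ↦ ?_) ?_
    · rw [dist_comm, Real.dist_eq]
      exact abs_sub_landen_iterate_le hF h n hx
    · simpa using (tendsto_pow_atTop_nhds_zero_of_lt_one (r := (1 / 2 : ℝ)) (by norm_num)
        (by norm_num)).const_mul x

end CauchyDivergence

namespace CauchyDivergence

open Set Filter Topology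

/-! ### Transforming a distance -/

/-- A function on `[0, ∞)` which turns distances into distances. -/
structure IsDistGauge (f : ℝ → ℝ) : Prop where
  map_zero : f 0 = 0
  pos : ∀ x, 0 < x → 0 < f x
  le_self : ∀ x, 0 ≤ x → f x ≤ x
  mono : ∀ x y, 0 ≤ x → x ≤ y → f x ≤ f y
  mul_lt : ∀ x y, 0 < x → x < y → f y * x < f x * y

namespace IsDistGauge

variable {f : ℝ → ℝ} {X : Type*} [MetricSpace X]

/-- Since `f t / t` decreases, `f x` and `f y` are at least their proportional shares of `f (x +
y)`. -/
theorem map_add_le (hf : IsDistGauge f) {x y : ℝ} (hx : 0 ≤ x) (hy : 0 ≤ y) :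
    f (x + y) ≤ f x + f y := by
  rcases hx.eq_or_lt with rfl | hx
  · simp [hf.map_zero]
  rcases hy.eq_or_lt with rfl | hy
  · simp [hf.map_zero]
  have h1 := hf.mul_lt x (x + y) hx (by linarith)
  have h2 := hf.mul_lt y (x + y) hy (by linarith)
  have : f (x + y) * (x + y) ≤ (f x + f y) * (x + y) := by linarith
  exact le_of_mul_le_mul_right this (by positivity)

theorem map_two_mul_lt (hf : IsDistGauge f) {x : ℝ} (hx : 0 < x) : f (2 * x) < 2 * f x := by
  have := hf.mul_lt x (2 * x) hx (by linarith)
  nlinarith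

theorem map_dist_triangle (hf : IsDistGauge f) (x y z : X) :
    f (dist x z) ≤ f (dist x y) + f (dist y z) :=
  (hf.mono _ _ dist_nonneg (dist_triangle x y z)).trans (hf.map_add_le dist_nonneg dist_nonneg)

theorem lt_of_map_lt (hf : IsDistGauge f) {x y : ℝ} (hy : 0 ≤ y) (h : f x < f y) : x < y := by
  by_contra! hxy
  exact h.not_ge (hf.mono y x hy hxy)

theorem of_sqrt {F : ℝ → ℝ} (h0 : F 0 = 0) (hpos : ∀ x, 0 < x → 0 < F x)
    (hle : ∀ x, 0 ≤ x → F x ≤ x ^ 2) (hmono : ∀ x y, 0 ≤ x → x ≤ y → F x ≤ F y)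
    (hlt : ∀ x y, 0 < x → x < y → F y * x ^ 2 < F x * y ^ 2) :
    IsDistGauge fun x ↦ √(F x) where
  map_zero := by simp [h0]
  pos x hx := Real.sqrt_pos.2 (hpos x hx)
  le_self x hx := Real.sqrt_le_left hx |>.2 (hle x hx)
  mono x y hx hxy := Real.sqrt_le_sqrt (hmono x y hx hxy)
  mul_lt x y hx hxy := by
    have hy := hx.trans hxy
    have := Real.sqrt_lt_sqrt (mul_nonneg (hpos y hy).le (sq_nonneg x)) (hlt x y hx hxy)
    rwa [Real.sqrt_mul (hpos y hy).le, Real.sqrt_mul (hpos x hx).le, Real.sqrt_sq hx.le,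
      Real.sqrt_sq hy.le] at this

/-- The metric `f ∘ dist`. -/
@[reducible] noncomputable def metricSpace (hf : IsDistGauge f) (X : Type*) [MetricSpace X] :
    MetricSpace X where
  dist x y := f (dist x y)
  dist_self x := by simp [hf.map_zero]
  dist_comm x y := by rw [dist_comm]
  dist_triangle := hf.map_dist_triangle
  eq_of_dist_eq_zero {x y} h := by
    by_contra hxy
    exact (hf.pos _ (dist_pos.2 hxy)).ne' h

/-- Monotonicity turns `f (dist) < f ε` into `dist < ε`, so Cauchy sequences stay Cauchy for `dist`;
`f x ≤ x` carries the limit back. -/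
theorem completeSpace (hf : IsDistGauge f) (X : Type*) [i : MetricSpace X] [CompleteSpace X] :
    @CompleteSpace X (hf.metricSpace X).toPseudoMetricSpace.toUniformSpace := by
  refine @Metric.complete_of_cauchySeq_tendsto X (hf.metricSpace X).toPseudoMetricSpace ?_
  intro u hu
  have hu' : ∀ ε > 0, ∃ N, ∀ m ≥ N, ∀ n ≥ N, f (dist (u m) (u n)) < ε :=
    (@Metric.cauchySeq_iff X ℕ (hf.metricSpace X).toPseudoMetricSpace _ _ u).1 hu
  have hc : CauchySeq u := by
    refine Metric.cauchySeq_iff.2 fun ε hε ↦ ?_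
    obtain ⟨N, hN⟩ := hu' (f ε) (hf.pos ε hε)
    exact ⟨N, fun m hm n hn ↦ hf.lt_of_map_lt hε.le (hN m hm n hn)⟩
  obtain ⟨a, ha⟩ := cauchySeq_tendsto_of_complete hc
  refine ⟨a, (@tendsto_iff_dist_tendsto_zero X ℕ (hf.metricSpace X).toPseudoMetricSpace
    u atTop a).2 ?_⟩
  change Tendsto (fun n ↦ f (dist (u n) a)) atTop (𝓝 0)
  refine squeeze_zero (fun n ↦ ?_) (fun n ↦ hf.le_self _ dist_nonneg)
    (tendsto_iff_dist_tendsto_zero.1 ha)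
  rw [← hf.map_zero]
  exact hf.mono _ _ le_rfl dist_nonneg

/-- Approximate midpoints do not exist for the distance `f ∘ dist`. -/
theorem not_forall_exists_approx_midpoint (hf : IsDistGauge f) {x y : X} (hxy : x ≠ y) :
    ¬ ∀ ε > 0, ∃ m : X, f (dist x m) ≤ f (dist x y) / 2 + ε ∧
      f (dist m y) ≤ f (dist x y) / 2 + ε := by
  intro h
  have hd := dist_pos.2 hxy
  have hlt := hf.map_two_mul_lt (half_pos hd)
  rw [mul_div_cancel₀ _ two_ne_zero] at hlt
  -- Taking `ε` as half the gap keeps both values below `f (dist x y / 2)`, so both distances fall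
  -- below half of `dist x y`.
  obtain ⟨m, h1, h2⟩ := h ((f (dist x y / 2) - f (dist x y) / 2) / 2) (by linarith)
  have h3 : dist x m < dist x y / 2 := hf.lt_of_map_lt (half_pos hd).le (by linarith)
  have h4 : dist m y < dist x y / 2 := hf.lt_of_map_lt (half_pos hd).le (by linarith)
  linarith [dist_triangle x m y]

theorem not_isGeodesicSpace (hf : IsDistGauge f) (X : Type*) [MetricSpace X] [Nontrivial X] :
    ¬ @IsGeodesicSpace X (hf.metricSpace X) := by
  intro h
  obtain ⟨x, y, hxy⟩ := exists_pair_ne X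
  refine hf.not_forall_exists_approx_midpoint hxy fun ε hε ↦ ?_
  obtain ⟨γ, h0, h1, hγ⟩ := h x y
  change γ (f (dist x y)) = y at h1
  change ∀ s ∈ Icc 0 (f (dist x y)), ∀ t ∈ Icc 0 (f (dist x y)), f (dist (γ s) (γ t)) = |s - t| at hγ
  have hd := hf.pos _ (dist_pos.2 hxy)
  have h2 := hγ 0 ⟨le_rfl, hd.le⟩ (f (dist x y) / 2) ⟨by linarith, by linarith⟩
  have h3 := hγ (f (dist x y) / 2) ⟨by linarith, by linarith⟩ (f (dist x y)) ⟨hd.le, le_rfl⟩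
  rw [h0, zero_sub, abs_neg, abs_of_pos (half_pos hd)] at h2
  rw [h1, abs_of_neg (by linarith)] at h3
  exact ⟨γ (f (dist x y) / 2), by linarith, by linarith⟩

theorem continuous_map_dist (hf : IsDistGauge f) (x : X) : Continuous fun y ↦ f (dist x y) := by
  refine (LipschitzWith.of_dist_le_mul (K := 1) fun y z ↦ ?_).continuous
  rw [Real.dist_eq, NNReal.coe_one, one_mul, abs_le]
  have h1 := hf.map_dist_triangle x y z
  have h2 := hf.map_dist_triangle x z y
  have h3 := hf.le_self _ (dist_nonneg (x := y) (y := z))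
  rw [dist_comm z y] at h2
  constructor <;> linarith

open Manifold in
-- On a path of length less than `d z w + ε`, the intermediate value theorem gives a point at
-- `d`-distance `d z w / 2` from `z`. Additivity of length then makes it an approximate midpoint.
theorem not_isRiemannianDistance (hf : IsDistGauge f) :
    ¬ IsRiemannianDistance fun z w ↦ f (dist z w) := by
  rintro ⟨g, hg⟩
  obtain ⟨z, w, hzw⟩ := exists_pair_ne ℍ
  refine hf.not_forall_exists_approx_midpoint hzw fun ε hε ↦ ?_
  let _ : Bundle.RiemannianBundle (fun z : ℍ ↦ TangentSpace 𝓘(ℝ, ℂ) z) := ⟨g.toRiemannianMetric⟩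
  replace hg (z w : ℍ) : f (dist z w) = (riemannianEDist 𝓘(ℝ, ℂ) z w).toReal := hg z w
  have hd := hf.pos _ (dist_pos.2 hzw)
  -- An infinite distance would have `toReal` equal to `0`, contradicting `hd`.
  have htop : riemannianEDist 𝓘(ℝ, ℂ) z w ≠ ⊤ := by
    intro h
    rw [hg, h] at hd
    simp at hd
  obtain ⟨γ, h0, h1, hγ, hlen⟩ := exists_lt_of_riemannianEDist_lt
    (ENNReal.lt_add_right htop (ENNReal.ofReal_pos.2 hε).ne')
  have hcont : ContinuousOn (fun t ↦ f (dist z (γ t))) (Icc 0 1) :=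
    (hf.continuous_map_dist z).comp_continuousOn hγ.continuousOn
  obtain ⟨t, ht, hmid⟩ : f (dist z w) / 2 ∈ (fun t ↦ f (dist z (γ t))) '' Icc 0 1 := by
    refine intermediate_value_Icc zero_le_one hcont ?_
    simp only [h0, h1, dist_self, hf.map_zero]
    constructor <;> linarith
  refine ⟨γ t, by linarith, ?_⟩
  have hL1 := riemannianEDist_le_pathELength (hγ.mono (Icc_subset_Icc_right ht.2)) h0 rfl ht.1
  have hL2 := riemannianEDist_le_pathELength (hγ.mono (Icc_subset_Icc_left ht.1)) rfl h1 ht.2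
  have hsum := (add_le_add hL1 hL2).trans_lt
    ((pathELength_add (I := 𝓘(ℝ, ℂ)) (γ := γ) ht.1 ht.2).trans_lt hlen)
  have hfin : riemannianEDist 𝓘(ℝ, ℂ) z (γ t) + riemannianEDist 𝓘(ℝ, ℂ) (γ t) w ≠ ⊤ :=
    hsum.ne_top
  have hreal := ENNReal.toReal_mono (ENNReal.add_ne_top.2 ⟨htop, ENNReal.ofReal_ne_top⟩) hsum.le
  rw [ENNReal.add_ne_top] at hfin
  rw [ENNReal.toReal_add hfin.1 hfin.2, ENNReal.toReal_add htop ENNReal.ofReal_ne_top,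
    ENNReal.toReal_ofReal hε.le, ← hg, ← hg, ← hg] at hreal
  dsimp only at hmid
  linarith

end IsDistGauge

end CauchyDivergence

namespace CauchyDivergence

open Set MeasureTheory

/-! ### Divergences as integrals over the circle -/

theorem density_eq_div (z : ℍ) (x : ℝ) :
    density z x = z.im / (Real.pi * ((x - z.re) ^ 2 + z.im ^ 2)) := by
  rw [density, ProbabilityTheory.cauchyPDFReal_def, Real.coe_toNNReal _ z.im_pos.le,
    div_eq_mul_inv, mul_inv]
  ring

theorem density_pos (z : ℍ) (x : ℝ) : 0 < density z x := by
  rw [density_eq_div]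
  have := z.im_pos
  positivity

theorem integral_eq_integral_tan {c y : ℝ} (hy : 0 < y) (g : ℝ → ℝ) :
    ∫ x, g x = ∫ φ in Ioo (-(Real.pi / 2)) (Real.pi / 2),
      y / Real.cos φ ^ 2 * g (c + y * Real.tan φ) := by
  have himage : (fun φ ↦ c + y * Real.tan φ) '' Ioo (-(Real.pi / 2)) (Real.pi / 2) = univ := by
    rw [← image_image (fun t ↦ c + y * t) Real.tan, Real.image_tan_Ioo, image_univ]
    refine Function.Surjective.range_eq fun x ↦ ⟨(x - c) / y, ?_⟩
    field_simp
    ring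
  rw [← setIntegral_univ, ← himage, integral_image_eq_integral_abs_deriv_smul measurableSet_Ioo
    (f' := fun φ ↦ y * (1 / Real.cos φ ^ 2))]
  · refine setIntegral_congr_fun measurableSet_Ioo fun φ _ ↦ ?_
    have : 0 ≤ y / Real.cos φ ^ 2 := by positivity
    simp only [smul_eq_mul, mul_one_div, abs_of_nonneg this]
  · intro φ hφ
    exact (((Real.hasDerivAt_tan (Real.cos_pos_of_mem_Ioo hφ).ne').const_mul y).const_add
      c).hasDerivWithinAt
  · intro φ hφ ψ hψ h
    have h : c + y * Real.tan φ = c + y * Real.tan ψ := h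
    exact Real.tan_inj_of_lt_of_lt_pi_div_two hφ.1 hφ.2 hψ.1 hψ.2
      (mul_left_cancel₀ hy.ne' (add_left_cancel h))

/-- The left side is a quadratic form in `(cos φ, sin φ)`, hence a constant plus a sinusoid in `2 *
φ`. Its determinant is `(z.im * w.im) ^ 2`, so `cosh ^ 2 - sinh ^ 2 = 1` gives the amplitude; the
phase is the argument of `ζ`. -/
theorem exists_dist_phase (z w : ℍ) : ∃ δ : ℝ, ∀ φ : ℝ,
    ((z.re - w.re) * Real.cos φ + z.im * Real.sin φ) ^ 2 + (w.im * Real.cos φ) ^ 2 =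
      z.im * w.im * (Real.cosh (dist z w) - Real.sinh (dist z w) * Real.cos (2 * φ - δ)) := by
  have hz := z.im_pos
  have hw := w.im_pos
  obtain ⟨a, ha⟩ : ∃ a, a = z.re - w.re := ⟨_, rfl⟩
  set ζ : ℂ := ⟨-((a ^ 2 + w.im ^ 2 - z.im ^ 2) / 2), -(a * z.im)⟩ with hζ
  have hcosh : z.im * w.im * Real.cosh (dist z w) = (a ^ 2 + z.im ^ 2 + w.im ^ 2) / 2 := by
    rw [UpperHalfPlane.cosh_dist', ha]
    field_simp
  have hnorm : ‖ζ‖ = z.im * w.im * Real.sinh (dist z w) := by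
    have h0 : 0 ≤ z.im * w.im * Real.sinh (dist z w) :=
      mul_nonneg (mul_pos hz hw).le (Real.sinh_nonneg_iff.2 dist_nonneg)
    rw [← abs_of_nonneg (norm_nonneg ζ), ← abs_of_nonneg h0, ← sq_eq_sq_iff_abs_eq_abs,
      ← Complex.normSq_eq_norm_sq, Complex.normSq_apply, mul_pow, Real.sinh_sq, mul_sub,
      ← mul_pow _ (Real.cosh _), hcosh]
    simp only [hζ]
    ring
  have h1 := Complex.norm_mul_cos_arg ζ
  have h2 := Complex.norm_mul_sin_arg ζ
  rw [hnorm] at h1 h2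
  refine ⟨ζ.arg, fun φ ↦ ?_⟩
  replace h1 := h1.trans (congrArg Complex.re hζ)
  replace h2 := h2.trans (congrArg Complex.im hζ)
  dsimp only at h1 h2
  rw [← ha, mul_sub, hcosh, Real.cos_sub, Real.cos_two_mul, Real.sin_two_mul]
  linear_combination (2 * Real.cos φ ^ 2 - 1) * h1 + 2 * Real.sin φ * Real.cos φ * h2 +
    (z.im ^ 2) * Real.sin_sq_add_cos_sq φ

theorem density_div_density (z w : ℍ) {φ : ℝ} (hφ : 0 < Real.cos φ) :
    density w (z.re + z.im * Real.tan φ) / density z (z.re + z.im * Real.tan φ) =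
      z.im * w.im / (((z.re - w.re) * Real.cos φ + z.im * Real.sin φ) ^ 2 +
        (w.im * Real.cos φ) ^ 2) := by
  have hz := z.im_pos
  have hw := w.im_pos
  have hpi := Real.pi_pos
  rw [density_eq_div, density_eq_div, Real.tan_eq_sin_div_cos]
  have h1 : (z.re + z.im * (Real.sin φ / Real.cos φ) - z.re) ^ 2 + z.im ^ 2 =
      z.im ^ 2 / Real.cos φ ^ 2 := by
    rw [eq_div_iff (by positivity)]
    have := Real.sin_sq_add_cos_sq φ
    field_simp
    linear_combination z.im ^ 2 * this
  have h2 : (z.re + z.im * (Real.sin φ / Real.cos φ) - w.re) ^ 2 + w.im ^ 2 =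
      (((z.re - w.re) * Real.cos φ + z.im * Real.sin φ) ^ 2 +
        (w.im * Real.cos φ) ^ 2) / Real.cos φ ^ 2 := by
    field_simp
    ring
  have h3 : 0 < ((z.re - w.re) * Real.cos φ + z.im * Real.sin φ) ^ 2 +
        (w.im * Real.cos φ) ^ 2 := by positivity
  rw [h1, h2]
  field_simp

/-- An `f`-divergence between Cauchy densities only depends on the hyperbolic distance. -/
theorem integral_density_mul (h : ℝ → ℝ) (z w : ℍ) :
    ∫ x, density z x * h (density w x / density z x) = (2 * Real.pi)⁻¹ *
      ∫ t in (0)..(2 * Real.pi),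
        h (1 / (Real.cosh (dist z w) - Real.sinh (dist z w) * Real.cos t)) := by
  have hz := z.im_pos
  have hw := w.im_pos
  have hpi := Real.pi_pos
  obtain ⟨δ, hδ⟩ := exists_dist_phase z w
  set k : ℝ → ℝ := fun t ↦
    h (1 / (Real.cosh (dist z w) - Real.sinh (dist z w) * Real.cos t)) with hk
  have hper : Function.Periodic k (2 * Real.pi) := fun t ↦ by simp [hk]
  have hstep : ∫ x, density z x * h (density w x / density z x) =
      ∫ φ in Ioo (-(Real.pi / 2)) (Real.pi / 2), Real.pi⁻¹ * k (2 * φ - δ) := by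
    rw [integral_eq_integral_tan (c := z.re) hz]
    refine setIntegral_congr_fun measurableSet_Ioo fun φ hφ ↦ ?_
    have hc := Real.cos_pos_of_mem_Ioo hφ
    simp only [density_div_density z w hc, hδ, hk]
    rw [← div_div, div_self (mul_pos hz hw).ne', ← mul_assoc, density_eq_div,
      Real.tan_eq_sin_div_cos]
    congr 1
    have := Real.sin_sq_add_cos_sq φ
    have h1 : (z.re + z.im * (Real.sin φ / Real.cos φ) - z.re) ^ 2 + z.im ^ 2 =
        z.im ^ 2 / Real.cos φ ^ 2 := by
      rw [eq_div_iff (by positivity)]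
      field_simp
      linear_combination z.im ^ 2 * this
    rw [h1]
    field_simp
  -- As `φ` crosses its interval, `2 * φ - δ` covers one full period, so `δ` drops out.
  rw [hstep, integral_const_mul, ← integral_Ioc_eq_integral_Ioo,
    ← intervalIntegral.integral_of_le (by linarith),
    intervalIntegral.integral_comp_mul_sub k two_ne_zero δ,
    show 2 * (Real.pi / 2) - δ = 2 * -(Real.pi / 2) - δ + 2 * Real.pi by ring,
    hper.intervalIntegral_add_eq _ 0, zero_add, smul_eq_mul, mul_inv, ← mul_assoc]
  ring

theorem exp_neg_le_cosh_sub {x : ℝ} (hx : 0 ≤ x) (t : ℝ) :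
    Real.exp (-x) ≤ Real.cosh x - Real.sinh x * Real.cos t := by
  rw [← Real.cosh_sub_sinh]
  nlinarith [Real.cos_le_one t, Real.sinh_nonneg_iff.2 hx]

theorem cosh_sub_le_exp {x : ℝ} (hx : 0 ≤ x) (t : ℝ) :
    Real.cosh x - Real.sinh x * Real.cos t ≤ Real.exp x := by
  rw [← Real.cosh_add_sinh]
  nlinarith [Real.neg_one_le_cos t, Real.sinh_nonneg_iff.2 hx]

theorem cosh_sub_pos {x : ℝ} (hx : 0 ≤ x) (t : ℝ) :
    0 < Real.cosh x - Real.sinh x * Real.cos t :=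
  (Real.exp_pos _).trans_le (exp_neg_le_cosh_sub hx t)

/-! ### The Kullback-Leibler divergence -/

theorem cosh_sub_eq_norm_sq (x t : ℝ) : Real.cosh x - Real.sinh x * Real.cos t =
    Real.cosh (x / 2) ^ 2 * ‖circleMap 0 1 t - (Real.tanh (x / 2) : ℝ)‖ ^ 2 := by
  obtain ⟨r, rfl⟩ : ∃ r, x = 2 * r := ⟨x / 2, by ring⟩
  have hc := (Real.cosh_pos r).ne'
  rw [← Complex.normSq_eq_norm_sq, Complex.normSq_apply, mul_div_cancel_left₀ _ two_ne_zero,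
    Real.cosh_two_mul, Real.sinh_two_mul, Real.tanh_eq_sinh_div_cosh]
  simp only [circleMap_zero, Complex.sub_re, Complex.sub_im, Complex.ofReal_re, Complex.ofReal_im,
    Complex.ofReal_one, one_mul, Complex.exp_ofReal_mul_I_re, Complex.exp_ofReal_mul_I_im]
  have := Real.sin_sq_add_cos_sq t
  field_simp
  linear_combination -Real.cosh r ^ 2 * this

/-- By Jensen's formula, `log ‖e^{it} - a‖` has mean zero on the circle when `‖a‖ < 1`; here `a =
tanh (x / 2)`, and only the factor `cosh (x / 2) ^ 2` contributes. -/
theorem integral_log_cosh_sub {x : ℝ} (hx : 0 ≤ x) :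
    ∫ t in (0)..(2 * Real.pi), Real.log (Real.cosh x - Real.sinh x * Real.cos t) =
      2 * Real.pi * (2 * logCosh (x / 2)) := by
  have htanh : ‖((Real.tanh (x / 2) : ℝ) : ℂ)‖ < 1 := by
    rw [Complex.norm_real, Real.norm_eq_abs]
    exact Real.abs_tanh_lt_one _
  have h0 := circleAverage_log_norm_sub_const₀ htanh
  rw [Real.circleAverage_def, smul_eq_mul] at h0
  have h0 := (mul_eq_zero.1 h0).resolve_left (by positivity)
  have hint : IntervalIntegrable
      (fun t ↦ Real.log ‖circleMap 0 1 t - (Real.tanh (x / 2) : ℝ)‖) volume 0 (2 * Real.pi) :=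
    circleIntegrable_log_norm_sub_const (c := 0) 1
  calc
    _ = ∫ t in (0)..(2 * Real.pi), (2 * logCosh (x / 2) +
        2 * Real.log ‖circleMap 0 1 t - (Real.tanh (x / 2) : ℝ)‖) := by
      refine intervalIntegral.integral_congr fun t _ ↦ ?_
      have hpos := cosh_sub_pos hx t
      rw [cosh_sub_eq_norm_sq] at hpos
      rw [cosh_sub_eq_norm_sq]
      rw [Real.log_mul (by positivity) (pos_of_mul_pos_right hpos (sq_nonneg _)).ne', Real.log_pow, Real.log_pow,
        logCosh, Nat.cast_ofNat]
    _ = _ := by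
      rw [intervalIntegral.integral_add (by simp) (hint.const_mul 2),
        intervalIntegral.integral_const_mul, intervalIntegral.integral_const_mul, h0]
      simp only [intervalIntegral.integral_const, smul_eq_mul]
      ring

theorem klDivergence_density (z w : ℍ) :
    klDivergence (density z) (density w) = 2 * logCosh (dist z w / 2) := by
  have h := integral_density_mul (fun s ↦ Real.log s⁻¹) z w
  simp only [inv_div, div_one] at h
  rw [klDivergence, h, integral_log_cosh_sub dist_nonneg]
  field_simp

/-! ### The Bhattacharyya divergence -/

/-- The integral `∫ √(p_z p_w)`, as a function of the hyperbolic distance of `z` and `w`. -/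
noncomputable def bhatCoeff (x : ℝ) : ℝ :=
  (2 * Real.pi)⁻¹ * ∫ t in (0)..(2 * Real.pi), √(1 / (Real.cosh x - Real.sinh x * Real.cos t))

theorem integral_sqrt_density (z w : ℍ) :
    ∫ x, √(density z x * density w x) = bhatCoeff (dist z w) := by
  rw [bhatCoeff, ← integral_density_mul Real.sqrt z w]
  congr 1 with x
  have hz := density_pos z x
  rw [← Real.sqrt_sq hz.le, ← Real.sqrt_mul (sq_nonneg _), Real.sqrt_sq hz.le]
  congr 1
  field_simp

theorem continuous_bhat_integrand {x : ℝ} (hx : 0 ≤ x) :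
    Continuous fun t ↦ √(1 / (Real.cosh x - Real.sinh x * Real.cos t)) := by
  refine Real.continuous_sqrt.comp (continuous_const.div ?_ fun t ↦ (cosh_sub_pos hx t).ne')
  fun_prop

theorem exp_neg_le_bhatCoeff {x : ℝ} (hx : 0 ≤ x) : Real.exp (-x) ≤ bhatCoeff x := by
  have hpi := Real.pi_pos
  have h := intervalIntegral.integral_mono_on (μ := volume) (a := 0) (b := 2 * Real.pi)
    (by positivity) (f := fun _ ↦ Real.exp (-x)) (by simp)
    ((continuous_bhat_integrand hx).intervalIntegrable _ _) fun t _ ↦ by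
      refine Real.le_sqrt_of_sq_le ?_
      rw [le_div_iff₀ (cosh_sub_pos hx t), sq]
      have h1 := cosh_sub_le_exp hx t
      have h2 : Real.exp (-x) ≤ 1 := Real.exp_le_one_iff.2 (by linarith)
      have h3 : Real.exp (-x) * Real.exp x = 1 := by rw [← Real.exp_add]; simp
      nlinarith [Real.exp_pos (-x), Real.exp_pos x]
  rw [intervalIntegral.integral_const, smul_eq_mul, sub_zero] at h
  rwa [bhatCoeff, le_inv_mul_iff₀ (by positivity)]

theorem bhatCoeff_le_exp {x : ℝ} (hx : 0 ≤ x) : bhatCoeff x ≤ Real.exp x := by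
  have hpi := Real.pi_pos
  have h := intervalIntegral.integral_mono_on (μ := volume) (a := 0) (b := 2 * Real.pi)
    (by positivity) (g := fun _ ↦ Real.exp x)
    ((continuous_bhat_integrand hx).intervalIntegrable _ _) (by simp) fun t _ ↦ by
      refine Real.sqrt_le_iff.2 ⟨(Real.exp_pos x).le, ?_⟩
      rw [div_le_iff₀ (cosh_sub_pos hx t), sq]
      have h1 := exp_neg_le_cosh_sub hx t
      have h2 : 1 ≤ Real.exp x := Real.one_le_exp hx
      have h3 : Real.exp (-x) * Real.exp x = 1 := by rw [← Real.exp_add]; simp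
      nlinarith [Real.exp_pos (-x), Real.exp_pos x]
  rw [intervalIntegral.integral_const, smul_eq_mul, sub_zero] at h
  rwa [bhatCoeff, inv_mul_le_iff₀ (by positivity)]

/-! ### Landen's transformation of the Bhattacharyya coefficient -/

theorem integral_eq_integral_sinh (g : ℝ → ℝ) :
    ∫ x, g x = ∫ u, Real.cosh u * g (Real.sinh u) := by
  have h := integral_image_eq_integral_abs_deriv_smul (f := Real.sinh) (f' := Real.cosh)
    MeasurableSet.univ (fun u _ ↦ (Real.hasDerivAt_sinh u).hasDerivWithinAt)
    Real.sinh_injective.injOn g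
  rw [image_univ, Real.sinh_surjective.range_eq, setIntegral_univ, setIntegral_univ] at h
  simpa [abs_of_pos (Real.cosh_pos _)] using h

theorem integral_eq_integral_exp_of_even {g : ℝ → ℝ} (hg : ∀ x, g |x| = g x) :
    ∫ x, g x = ∫ u, 2 * (Real.exp u * g (Real.exp u)) := by
  have h := integral_image_eq_integral_abs_deriv_smul (f := Real.exp) (f' := Real.exp)
    MeasurableSet.univ (fun u _ ↦ (Real.hasDerivAt_exp u).hasDerivWithinAt)
    Real.exp_injective.injOn g
  rw [image_univ, Real.range_exp, setIntegral_univ] at h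
  have h2 := integral_comp_abs (f := g)
  simp only [hg] at h2
  rw [h2, h, integral_const_mul]
  simp

/-- The point `i * exp s`. -/
noncomputable def iExp (s : ℝ) : ℍ := ⟨⟨0, Real.exp s⟩, Real.exp_pos s⟩

theorem dist_iExp (s t : ℝ) : dist (iExp s) (iExp t) = |s - t| := by
  exact ((UpperHalfPlane.isometry_vertical_line 0).dist_eq s t).trans (Real.dist_eq s t)

theorem density_iExp (s x : ℝ) :
    density (iExp s) x = Real.exp s / (Real.pi * (x ^ 2 + Real.exp s ^ 2)) := by
  rw [density_eq_div]
  simp [iExp]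

/-- The coefficient depends only on distance, so convenient pairs are chosen: `i e^r, i e^{-r}` at
distance `2 * r`, and `i cosh r, i` at distance `logCosh r`. Substituting `x = e^u` in the first
integral and `x = sinh u` in the second makes the integrands proportional. -/
theorem bhatCoeff_eq {x : ℝ} (hx : 0 ≤ x) :
    bhatCoeff x = (√(Real.cosh (x / 2)))⁻¹ * bhatCoeff (logCosh (x / 2)) := by
  obtain ⟨r, rfl⟩ : ∃ r, x = 2 * r := ⟨x / 2, by ring⟩
  rw [mul_div_cancel_left₀ _ two_ne_zero]
  have h1 : dist (iExp r) (iExp (-r)) = 2 * r := by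
    rw [dist_iExp, sub_neg_eq_add, ← two_mul, abs_of_nonneg hx]
  have h2 : dist (iExp (logCosh r)) (iExp 0) = logCosh r := by
    rw [dist_iExp, sub_zero, abs_of_nonneg (logCosh_nonneg r)]
  rw [← h1, ← h2, ← integral_sqrt_density, ← integral_sqrt_density,
    integral_eq_integral_exp_of_even (by simp [density_iExp]), integral_eq_integral_sinh
      fun x ↦ √(density (iExp (logCosh r)) x * density (iExp 0) x),
    ← integral_const_mul]
  congr 1 with u
  have hc := Real.cosh_pos r
  have hu := Real.cosh_pos u
  have hpi := Real.pi_pos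
  rw [← sq_eq_sq₀ (by positivity) (by positivity)]
  have h3 (s t y : ℝ) : 0 ≤ density (iExp s) y * density (iExp t) y :=
    (mul_pos (density_pos _ _) (density_pos _ _)).le
  simp only [mul_pow, inv_pow, Real.sq_sqrt (h3 _ _ _), Real.sq_sqrt hc.le]
  simp only [density_iExp, exp_logCosh, Real.exp_zero]
  have h4 : Real.exp r * Real.exp (-r) = 1 := by rw [← Real.exp_add]; simp
  have h5 : (Real.exp u ^ 2 + Real.exp r ^ 2) * (Real.exp u ^ 2 + Real.exp (-r) ^ 2) =
      4 * Real.exp u ^ 2 * (Real.sinh u ^ 2 + Real.cosh r ^ 2) := by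
    have h6 : Real.exp u * Real.exp (-u) = 1 := by rw [← Real.exp_add]; simp
    rw [Real.sinh_eq, Real.cosh_eq]
    linear_combination (Real.exp r * Real.exp (-r) + 1 - 2 * Real.exp u ^ 2) * h4 +
      (2 * Real.exp u ^ 2 - (Real.exp u * Real.exp (-u) + 1)) * h6
  have h7 : 0 < Real.sinh u ^ 2 + Real.cosh r ^ 2 := by positivity
  rw [div_mul_div_comm, h4, show Real.pi * (Real.exp u ^ 2 + Real.exp r ^ 2) *
    (Real.pi * (Real.exp u ^ 2 + Real.exp (-r) ^ 2)) = Real.pi ^ 2 *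
      ((Real.exp u ^ 2 + Real.exp r ^ 2) * (Real.exp u ^ 2 + Real.exp (-r) ^ 2)) by ring, h5]
  rw [show Real.sinh u ^ 2 + 1 ^ 2 = Real.cosh u ^ 2 by rw [Real.cosh_sq]; ring]
  field_simp
  norm_num

theorem bhatCoeff_pos {x : ℝ} (hx : 0 ≤ x) : 0 < bhatCoeff x :=
  (Real.exp_pos _).trans_le (exp_neg_le_bhatCoeff hx)

/-- The Bhattacharyya divergence, as a function of the hyperbolic distance. -/
noncomputable def bhatGauge (x : ℝ) : ℝ := -Real.log (bhatCoeff x)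

theorem bhatDivergence_density (z w : ℍ) :
    bhatDivergence (density z) (density w) = bhatGauge (dist z w) := by
  rw [bhatDivergence, integral_sqrt_density, bhatGauge]

theorem bhatGauge_eq_landen {x : ℝ} (hx : 0 ≤ x) : bhatGauge x = landen bhatGauge x := by
  have hc := Real.cosh_pos (x / 2)
  rw [bhatGauge, bhatCoeff_eq hx, Real.log_mul (by positivity)
    (bhatCoeff_pos (logCosh_nonneg _)).ne', Real.log_inv, Real.log_sqrt hc.le, landen, bhatGauge,
    logCosh]
  ring

theorem abs_bhatGauge_le {x : ℝ} (hx : 0 ≤ x) : |bhatGauge x| ≤ x := by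
  rw [bhatGauge, abs_neg, abs_le, Real.le_log_iff_exp_le (bhatCoeff_pos hx),
    Real.log_le_iff_le_exp (bhatCoeff_pos hx)]
  exact ⟨exp_neg_le_bhatCoeff hx, bhatCoeff_le_exp hx⟩

/-! ### The two divergences as gauges of the hyperbolic distance -/

theorem isDistGauge_sqrt_bhatGauge : IsDistGauge fun x ↦ √(bhatGauge x) := by
  have h := isQuadraticGauge_of_eq_landen (fun x ↦ abs_bhatGauge_le) fun x ↦ bhatGauge_eq_landen
  refine .of_sqrt ?_ (fun x hx ↦ ?_) (fun x hx ↦ ?_) h.mono fun x y hx hxy ↦ ?_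
  · simpa using abs_bhatGauge_le le_rfl
  · rw [bhatGauge_eq_landen hx.le, landen]
    linarith [logCosh_pos (half_pos hx), h.nonneg _ (logCosh_nonneg (x / 2))]
  · linarith [h.le_sq x hx, sq_nonneg x]
  -- The limit of the iterates yields only a weak inequality; one more use of the functional
  -- equation makes it strict.
  · rw [bhatGauge_eq_landen hx.le, bhatGauge_eq_landen (hx.trans hxy).le]
    exact h.landen_mul_sq_lt hx hxy

theorem isDistGauge_sqrt_logCosh : IsDistGauge fun x ↦ √(2 * logCosh (x / 2)) := by
  refine .of_sqrt (by simp) (fun x hx ↦ ?_) (fun x hx ↦ ?_) (fun x y hx hxy ↦ ?_)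
    fun x y hx hxy ↦ ?_
  · linarith [logCosh_pos (half_pos hx)]
  · have := logCosh_sq_add_le (div_nonneg hx zero_le_two)
    nlinarith [sq_nonneg (logCosh (x / 2))]
  · linarith [logCosh_mono (div_nonneg hx zero_le_two) (by linarith : x / 2 ≤ y / 2)]
  · linarith [logCosh_half_mul_sq_lt hx hxy]

theorem sqrtKL_eq : sqrtKL = fun z w ↦ √(2 * logCosh (dist z w / 2)) := by
  ext z w
  rw [sqrtKL, klDivergence_density]

theorem sqrtBhat_eq : sqrtBhat = fun z w ↦ √(bhatGauge (dist z w)) := by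
  ext z w
  rw [sqrtBhat, bhatDivergence_density]

end CauchyDivergence

theorem mainTheorem10 :
    (∃ m : MetricSpace ℍ,
      (∀ z w : ℍ, m.dist z w = CauchyDivergence.sqrtKL z w) ∧
      @CompleteSpace ℍ m.toPseudoMetricSpace.toUniformSpace ∧
      ¬ @CauchyDivergence.IsGeodesicSpace ℍ m) ∧
    (∃ m : MetricSpace ℍ,
      (∀ z w : ℍ, m.dist z w = CauchyDivergence.sqrtBhat z w) ∧
      @CompleteSpace ℍ m.toPseudoMetricSpace.toUniformSpace ∧
      ¬ @CauchyDivergence.IsGeodesicSpace ℍ m) ∧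
    ¬ CauchyDivergence.IsRiemannianDistance CauchyDivergence.sqrtKL ∧
    ¬ CauchyDivergence.IsRiemannianDistance CauchyDivergence.sqrtBhat := by
  have hK := CauchyDivergence.isDistGauge_sqrt_logCosh
  have hB := CauchyDivergence.isDistGauge_sqrt_bhatGauge
  rw [CauchyDivergence.sqrtKL_eq, CauchyDivergence.sqrtBhat_eq]
  exact ⟨⟨hK.metricSpace ℍ, fun _ _ ↦ rfl, hK.completeSpace ℍ, hK.not_isGeodesicSpace ℍ⟩,
    ⟨hB.metricSpace ℍ, fun _ _ ↦ rfl, hB.completeSpace ℍ, hB.not_isGeodesicSpace ℍ⟩,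
    hK.not_isRiemannianDistance, hB.not_isRiemannianDistance⟩
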